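/- There is a deterministic oracle random access machine and a polynomial $p$ such that the following holds. Let $G$ be a finite group of order $N$, given by its multiplication table, let $T$ be a finite tree with $n$ nodes, given by its adjacency matrix, and let $r$ be a node of $T$, its root. Let $\mathrm{Aut}(T,r)$ be the group of graph automorphisms of $T$ that fix $r$, and call $G$ representable on the rooted tree $(T,r)$ if there is a nontrivial homomorphism (one that is not constantly $1$) from $G$ to $\mathrm{Aut}(T,r)$. Given $(G,T,r)$ and an oracle that, for each $m$ with $1\le m\le n$, correctly answers whether $G$ has a nontrivial homomorphism to the symmetric group $S_m$ (its answers for other $m$ may be arbitrary), the machine halts after at most $p(N+n)$ steps and decides correctly whether $G$ is representable on $(T,r)$. Here the machine has finitely many registers and finitely many random access arrays holding natural numbers. One step is an assignment of a constant, an addition, a truncated subtraction, a read or write of an array cell, an oracle query about the number in a register, or a test whether a register is zero (for branching or looping). -/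

import Mathlib

namespace OracleRAM

/-- The store of a random access machine: number-valued registers, and arrays of numbers with
random access. A given program mentions only finitely many registers and arrays. -/
structure Store where
  reg : ℕ → ℕ
  arr : ℕ → ℕ → ℕ

/-- Set register `x` to the value `v`. -/
def Store.setReg (s : Store) (x v : ℕ) : Store :=
  { s with reg := Function.update s.reg x v }

/-- Set cell `i` of array `a` to the value `v`. -/
def Store.setArr (s : Store) (a i v : ℕ) : Store :=
  { s with arr := Function.update s.arr a (Function.update (s.arr a) i v) }

/-- Programs of an oracle random access machine. Here `x`, `y`, `z`, `i` are names of registers,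
`a` is the name of an array and `c` is a numeral. There is no multiplication, so that after `t`
unit-cost steps all numbers have `O(t)` more bits than the input numbers, and unit cost is
polynomially related to Turing machine time. -/
inductive Program : Type
  /-- `x := c` -/
  | const (x c : ℕ)
  /-- `x := y + z` -/
  | add (x y z : ℕ)
  /-- `x := max (y - z) 0` -/
  | sub (x y z : ℕ)
  /-- `x := a[i]` -/
  | load (x a i : ℕ)
  /-- `a[i] := x` -/
  | store (a i x : ℕ)
  /-- ask the oracle about the number in `y`; `x := 1` if it answers yes, `x := 0` otherwise -/
  | query (x y : ℕ)
  /-- first `p`, then `q` -/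
  | seq (p q : Program)
  /-- `if x ≠ 0 then p else q` -/
  | cond (x : ℕ) (p q : Program)
  /-- `while x ≠ 0 do p` -/
  | loop (x : ℕ) (p : Program)

/-- `Run O p s t s'`: with oracle `O`, the program `p` started in the store `s` halts in the store
`s'` after exactly `t` steps. Every instruction, every oracle query and every test of a register
is one step. -/
inductive Run (O : ℕ → Bool) : Program → Store → ℕ → Store → Prop
  | const (x c : ℕ) (s : Store) : Run O (.const x c) s 1 (s.setReg x c)
  | add (x y z : ℕ) (s : Store) : Run O (.add x y z) s 1 (s.setReg x (s.reg y + s.reg z))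
  | sub (x y z : ℕ) (s : Store) : Run O (.sub x y z) s 1 (s.setReg x (s.reg y - s.reg z))
  | load (x a i : ℕ) (s : Store) : Run O (.load x a i) s 1 (s.setReg x (s.arr a (s.reg i)))
  | store (a i x : ℕ) (s : Store) : Run O (.store a i x) s 1 (s.setArr a (s.reg i) (s.reg x))
  | query (x y : ℕ) (s : Store) :
      Run O (.query x y) s 1 (s.setReg x (if O (s.reg y) = true then 1 else 0))
  | seq {p q : Program} {s s' s'' : Store} {t t' : ℕ} :
      Run O p s t s' → Run O q s' t' s'' → Run O (.seq p q) s (t + t') s''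
  | cond_true {x : ℕ} {p q : Program} {s s' : Store} {t : ℕ} :
      s.reg x ≠ 0 → Run O p s t s' → Run O (.cond x p q) s (t + 1) s'
  | cond_false {x : ℕ} {p q : Program} {s s' : Store} {t : ℕ} :
      s.reg x = 0 → Run O q s t s' → Run O (.cond x p q) s (t + 1) s'
  | loop_done {x : ℕ} {p : Program} {s : Store} :
      s.reg x = 0 → Run O (.loop x p) s 1 s
  | loop_step {x : ℕ} {p : Program} {s s' s'' : Store} {t t' : ℕ} :
      s.reg x ≠ 0 → Run O p s t s' → Run O (.loop x p) s' t' s'' →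
        Run O (.loop x p) s (t + 1 + t') s''

end OracleRAM

namespace GroupRep

/-- The automorphism group of the tree `T` with root `r`: the graph automorphisms that fix `r`. -/
def RootedAut {V : Type*} (T : SimpleGraph V) (r : V) : Subgroup (T ≃g T) where
  carrier := {φ | φ r = r}
  one_mem' := rfl
  mul_mem' := by
    intro φ ψ hφ hψ
    change φ (ψ r) = r
    rw [show ψ r = r from hψ]
    exact hφ
  inv_mem' := by
    intro φ hφ
    change φ.symm r = r
    rw [RelIso.symm_apply_eq]
    exact (show φ r = r from hφ).symm

/-- `G` is representable on the rooted tree: it has a nontrivial homomorphism to the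
automorphism group. -/
def RepresentableOn (G : Type*) [Group G] {V : Type*} (T : SimpleGraph V) (r : V) : Prop :=
  ∃ ρ : G →* RootedAut T r, ∃ g : G, ρ g ≠ 1

/-- `G` has a nontrivial homomorphism to the symmetric group `S_m`. -/
def HasNontrivialPermRep (G : Type*) [Group G] (m : ℕ) : Prop :=
  ∃ ρ : G →* Equiv.Perm (Fin m), ∃ g : G, ρ g ≠ 1

/-- The multiplication table, in row-major order, of a group of order `N` whose elements are
numbered `0, …, N - 1` by `e`: cell `i * N + j` holds the number of the product of the elements
numbered `i` and `j`. -/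
def mulTable {G : Type*} [Group G] {N : ℕ} (e : G ≃ Fin N) (k : ℕ) : ℕ :=
  if h : k < N * N then
    (e (e.symm (Fin.divNat ⟨k, h⟩) * e.symm (Fin.modNat ⟨k, h⟩)) : ℕ)
  else 0

open Classical in
/-- The adjacency matrix, in row-major order, of a graph with vertices `0, …, n - 1`: cell
`i * n + j` holds `1` if `i` and `j` are adjacent, `0` otherwise. -/
noncomputable def adjTable {n : ℕ} (T : SimpleGraph (Fin n)) (k : ℕ) : ℕ :=
  if h : k < n * n then
    (if T.Adj (Fin.divNat ⟨k, h⟩) (Fin.modNat ⟨k, h⟩) then 1 else 0)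
  else 0

/-- The initial store: the order of the group, the number of vertices and the root are in
registers 0, 1, 2, the multiplication table in array 0 and the adjacency matrix in array 1;
everything else is 0. -/
noncomputable def inputStore {G : Type*} [Group G] {N n : ℕ} (e : G ≃ Fin N)
    (T : SimpleGraph (Fin n)) (r : Fin n) : OracleRAM.Store where
  reg x := if x = 0 then N else if x = 1 then n else if x = 2 then (r : ℕ) else 0
  arr a := if a = 0 then mulTable e else if a = 1 then adjTable T else fun _ => 0

end GroupRep

/-! Let colour refinement, started from the partition that singles out the root `r`, run on the tree
until it stabilises, which takes at most as many rounds as there are vertices. Automorphisms that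
fix `r` preserve every class of the resulting partition, and the partition is equitable: equivalent
vertices have equally many neighbours in each class. A group `G` is representable on `(T, r)` if and
only if, for some adjacent `v` and `x`, it has a nontrivial homomorphism to the permutations of the
neighbours of `v` in the class of `x`; the number of these neighbours is what the oracle is asked
about.

If `G` acts nontrivially on the tree, then it moves some vertex `x` whose parent `v` it fixes, and
hence acts nontrivially on the neighbours of `v` in the class of `x`. Conversely, label the children
of each vertex by those of a representative of its class, in such a way that labels respect classes.
A vertex is then given by the sequence of labels on the way from the root, and a permutation of the
neighbours of the representative in one class acts on the tree by permuting, in all these sequences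
simultaneously, the labels among these neighbours.

On the machine, the relations and counts involved are values of expressions built from array
entries, comparisons and sums over all vertices. The cost of compiled code for an expression is a
polynomial in the number of vertices, of a degree that depends on the nesting of the sums. -/

namespace GroupRep

section Setoid

variable {α : Type*} [Finite α]

theorem eq_of_le_of_card_quotient_le {E F : Setoid α} (h : E ≤ F)
    (hcard : Nat.card (Quotient E) ≤ Nat.card (Quotient F)) : E = F := by
  let π : Quotient E → Quotient F := Quotient.map id fun _ _ h' => h h'
  have hπ : π.Surjective := Quotient.ind fun x => ⟨⟦x⟧, rfl⟩
  have hinj := (hπ.bijective_of_nat_card_le hcard).injective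
  exact h.antisymm fun x y hxy => Quotient.exact (@hinj ⟦x⟧ ⟦y⟧ (Quotient.sound hxy))

theorem isFixedPt_iterate_card {f : Setoid α → Setoid α} (hf : ∀ E, f E ≤ E) (E : Setoid α) :
    Function.IsFixedPt f (f^[Nat.card α] E) := by
  let c : ℕ → ℕ := fun k => Nat.card (Quotient (f^[k] E))
  have step (k : ℕ) : f^[k + 1] E ≤ f^[k] E := by
    rw [Function.iterate_succ_apply']
    exact hf _
  have hmono : Monotone c := monotone_nat_of_le_succ fun k =>
    Nat.card_le_card_of_surjective (Quotient.map id fun _ _ h => step k h)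
      (Quotient.ind fun x => ⟨⟦x⟧, rfl⟩)
  have hbound (k : ℕ) : c k ≤ Nat.card α :=
    Nat.card_le_card_of_surjective (Quotient.mk _) Quotient.mk_surjective
  have fixed_of_eq {k : ℕ} (hk : c k = c (k + 1)) : f^[k + 1] E = f^[k] E :=
    eq_of_le_of_card_quotient_le (step k) hk.ge
  have hstab (k : ℕ) (hk : c k = c (k + 1)) : c (k + 1) = c (k + 2) := by
    simp only [c, Function.iterate_succ_apply' f (k + 1), fixed_of_eq hk]
    rw [← Function.iterate_succ_apply' f, fixed_of_eq hk]
  have hlast : c (Nat.card α + 1) = c (Nat.card α) :=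
    Nat.stabilises_of_monotone hmono hbound hstab (Nat.le_succ _)
  rw [Function.IsFixedPt, ← Function.iterate_succ_apply' f]
  exact fixed_of_eq hlast.symm

end Setoid

section Refinement

variable {V : Type*} {T : SimpleGraph V} {r : V} {E : Setoid V}

/-- The neighbours of `v` in the class of `x`. -/
def nbrClass (T : SimpleGraph V) (E : Setoid V) (v x : V) : Set V :=
  {y | T.Adj v y ∧ E y x}

/-- The number of neighbours of `v` in the class of `x`; it is `0` if there are infinitely many. -/
noncomputable def nbrCount (T : SimpleGraph V) (E : Setoid V) (v x : V) : ℕ :=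
  Nat.card (nbrClass T E v x)

/-- One round of colour refinement: equivalent vertices stay equivalent if they have equally many
neighbours in each class. -/
noncomputable def refine (T : SimpleGraph V) (E : Setoid V) : Setoid V :=
  E ⊓ Setoid.ker (nbrCount T E)

/-- The partition of the vertices after `k` rounds of colour refinement, which starts from the
partition that singles out `r`. -/
noncomputable def colourRefinement (T : SimpleGraph V) (r : V) (k : ℕ) : Setoid V :=
  (refine T)^[k] (Setoid.ker (· = r))

theorem refine_le (T : SimpleGraph V) (E : Setoid V) : refine T E ≤ E :=
  inf_le_left

theorem colourRefinement_succ (k : ℕ) :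
    colourRefinement T r (k + 1) = refine T (colourRefinement T r k) :=
  Function.iterate_succ_apply' _ _ _

theorem colourRefinement_le (k : ℕ) : colourRefinement T r k ≤ Setoid.ker (· = r) :=
  Function.iterate_le_id_of_le_id (refine_le T) k _

theorem map_mem_nbrClass_iff {φ : T ≃g T} (hφ : ∀ u, E (φ u) u) {v x y : V} :
    φ y ∈ nbrClass T E (φ v) x ↔ y ∈ nbrClass T E v x :=
  and_congr φ.map_adj_iff ⟨E.trans' (E.symm' (hφ y)), E.trans' (hφ y)⟩

theorem refine_map {φ : T ≃g T} (hφ : ∀ u, E (φ u) u) (u : V) : refine T E (φ u) u := by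
  refine ⟨hφ u, funext fun w => ?_⟩
  exact (Nat.card_congr (φ.toEquiv.subtypeEquiv fun _ => (map_mem_nbrClass_iff hφ).symm)).symm

theorem colourRefinement_map {φ : T ≃g T} (hφ : φ ∈ RootedAut T r) (k : ℕ) (u : V) :
    colourRefinement T r k (φ u) u := by
  induction k generalizing u with
  | zero => exact propext ⟨fun h => φ.injective (h.trans hφ.symm), fun h => h ▸ hφ⟩
  | succ k ih =>
    rw [colourRefinement_succ]
    exact refine_map ih u

/-- A partition in which the root is alone in its class and equivalent vertices have equally many
neighbours in each class. -/
structure IsEquitable (T : SimpleGraph V) (r : V) (E : Setoid V) : Prop where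
  root : ∀ {u}, E u r → u = r
  count : ∀ {u v}, E u v → nbrCount T E u = nbrCount T E v

theorem isEquitable_colourRefinement [Finite V] (T : SimpleGraph V) (r : V) :
    IsEquitable T r (colourRefinement T r (Nat.card V)) where
  root h := (colourRefinement_le _ h).mpr rfl
  count h := by
    have hfix := isFixedPt_iterate_card (refine_le T) (Setoid.ker (· = r))
    rw [colourRefinement, ← hfix] at h
    exact h.2

end Refinement

section RootedTree

variable {V : Type*} {T : SimpleGraph V} {r : V}

open Classical in
/-- The neighbour of `z` on the way to the root `r`, or `z` itself if `z` is the root. -/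
noncomputable def parent (T : SimpleGraph V) (r z : V) : V :=
  if h : ∃ p, T.Adj p z ∧ T.dist r z = T.dist r p + 1 then h.choose else z

theorem exists_adj_dist_eq (hT : T.Connected) {z : V} (hz : z ≠ r) :
    ∃ p, T.Adj p z ∧ T.dist r z = T.dist r p + 1 := by
  obtain ⟨w, hw⟩ := hT.exists_walk_length_eq_dist z r
  cases w with
  | nil => exact absurd rfl hz
  | @cons _ p _ hadj w' =>
    refine ⟨p, hadj.symm, ?_⟩
    have hle := SimpleGraph.dist_le w'
    have htri := hT.dist_triangle (u := z) (v := p) (w := r)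
    rw [SimpleGraph.dist_eq_one_iff_adj.2 hadj] at htri
    rw [SimpleGraph.Walk.length_cons] at hw
    rw [SimpleGraph.dist_comm, SimpleGraph.dist_comm (u := r)]
    omega

theorem eq_of_adj_of_dist_eq (hT : T.IsTree) {p q z : V} (hp : T.Adj p z) (hq : T.Adj q z)
    (hdp : T.dist r z = T.dist r p + 1) (hdq : T.dist r z = T.dist r q + 1) : p = q := by
  have exists_path {a : V} (ha : T.Adj a z) (hd : T.dist r z = T.dist r a + 1) :
      ∃ w : T.Walk r z, w.IsPath ∧ w.penultimate = a := by
    obtain ⟨w, -, hl⟩ := hT.connected.exists_path_of_dist r a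
    exact ⟨w.concat ha, (w.concat ha).isPath_of_length_eq_dist (by simp [hl, hd]), by simp⟩
  obtain ⟨w₁, h₁, rfl⟩ := exists_path hp hdp
  obtain ⟨w₂, h₂, rfl⟩ := exists_path hq hdq
  rw [(hT.existsUnique_path r z).unique h₁ h₂]

theorem parent_spec (hT : T.IsTree) {z : V} (hz : z ≠ r) :
    T.Adj (parent T r z) z ∧ T.dist r z = T.dist r (parent T r z) + 1 := by
  have h := exists_adj_dist_eq hT.connected hz
  rw [parent, dif_pos h]
  exact h.choose_spec

theorem parent_adj (hT : T.IsTree) {z : V} (hz : z ≠ r) : T.Adj (parent T r z) z :=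
  (parent_spec hT hz).1

theorem dist_parent (hT : T.IsTree) {z : V} (hz : z ≠ r) :
    T.dist r z = T.dist r (parent T r z) + 1 :=
  (parent_spec hT hz).2

theorem ne_root_of_dist_eq {z : V} {d : ℕ} (hd : T.dist r z = d + 1) : z ≠ r := by
  rintro rfl
  simp at hd

theorem parent_eq (hT : T.IsTree) {p z : V} (hp : T.Adj p z)
    (hd : T.dist r z = T.dist r p + 1) : parent T r z = p :=
  have hz := ne_root_of_dist_eq hd
  eq_of_adj_of_dist_eq hT (parent_adj hT hz) hp (dist_parent hT hz) hd

theorem parent_eq_or_parent_eq (hT : T.IsTree) {a b : V} (h : T.Adj a b) :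
    (b ≠ r ∧ parent T r b = a) ∨ (a ≠ r ∧ parent T r a = b) :=
  (hT.dist_eq_dist_add_one_of_adj r h).symm.imp
    (fun hd => ⟨ne_root_of_dist_eq hd, parent_eq hT h hd⟩)
    (fun hd => ⟨ne_root_of_dist_eq hd, parent_eq hT h.symm hd⟩)

theorem rootedTree_induction (hT : T.IsTree) {P : V → Prop} (root : P r)
    (step : ∀ z, z ≠ r → P (parent T r z) → P z) (z : V) : P z := by
  induction h : T.dist r z generalizing z with
  | zero => rwa [← hT.connected.dist_eq_zero_iff.1 h]
  | succ d ih =>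
    have hz := ne_root_of_dist_eq h
    exact step z hz (ih _ (Nat.succ_injective ((dist_parent hT hz).symm.trans h)))

end RootedTree

section Equitable

variable {V : Type*} {T : SimpleGraph V} {r : V} {E : Setoid V}

theorem nonempty_nbrClass_iff [Finite V] {v x : V} :
    (nbrClass T E v x).Nonempty ↔ 0 < nbrCount T E v x := by
  rw [nbrCount, Nat.card_coe_set_eq, Set.ncard_pos]

theorem nbrCount_mem_Icc [Finite V] {v x : V} (h : T.Adj v x) :
    nbrCount T E v x ∈ Set.Icc 1 (Nat.card V) :=
  ⟨nonempty_nbrClass_iff.1 ⟨x, h, E.refl' x⟩, Finite.card_subtype_le _⟩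

namespace IsEquitable

theorem exists_adj [Finite V] (hE : IsEquitable T r E) {u v w : V} (h : E u v)
    (hw : T.Adj u w) : ∃ x, T.Adj v x ∧ E x w := by
  have hpos : 0 < nbrCount T E u w := nonempty_nbrClass_iff.1 ⟨w, hw, E.refl' w⟩
  rw [hE.count h] at hpos
  exact nonempty_nbrClass_iff.2 hpos

theorem dist_le [Finite V] (hE : IsEquitable T r E) (hT : T.IsTree) {u v : V} (h : E u v) :
    T.dist r v ≤ T.dist r u := by
  induction u using rootedTree_induction hT (r := r) generalizing v with
  | root => rw [hE.root (E.symm' h)]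
  | step u hu ih =>
    obtain ⟨x, hx, hxE⟩ := hE.exists_adj h (parent_adj hT hu).symm
    have hle := ih (E.symm' hxE)
    have hd := dist_parent hT hu
    rcases hT.dist_eq_dist_add_one_of_adj r hx with h | h <;> omega

theorem dist_eq [Finite V] (hE : IsEquitable T r E) (hT : T.IsTree) {u v : V} (h : E u v) :
    T.dist r u = T.dist r v :=
  (hE.dist_le hT (E.symm' h)).antisymm (hE.dist_le hT h)

theorem parent_eq_of_adj [Finite V] (hE : IsEquitable T r E) (hT : T.IsTree) {q z z' : V}
    (hz : z ≠ r) (hq : E q (parent T r z)) (ha : T.Adj q z') (h : E z' z) :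
    parent T r z' = q :=
  parent_eq hT ha (by rw [hE.dist_eq hT h, hE.dist_eq hT hq, dist_parent hT hz])

theorem ne_root (hE : IsEquitable T r E) {z z' : V} (hz : z ≠ r) (h : E z' z) :
    z' ≠ r := by
  rintro rfl
  exact hz (hE.root (E.symm' h))

theorem ne_root_and_parent_eq_of_ne [Finite V] (hE : IsEquitable T r E) (hT : T.IsTree)
    {v y y' : V} (hy : T.Adj v y) (hy' : T.Adj v y') (h : E y y') (hne : y ≠ y') :
    y ≠ r ∧ parent T r y = v := by
  have hd : T.dist r y = T.dist r v + 1 := by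
    refine (hT.dist_eq_dist_add_one_of_adj r hy).resolve_left fun hv => hne ?_
    exact eq_of_adj_of_dist_eq hT hy.symm hy'.symm hv (hE.dist_eq hT h ▸ hv)
  exact ⟨ne_root_of_dist_eq hd, parent_eq hT hy hd⟩

end IsEquitable

theorem exists_perm_of_card_fiber_eq {α β : Type*} [Finite α] {f g : α → β}
    (h : ∀ b, Nat.card {a // f a = b} = Nat.card {a // g a = b}) :
    ∃ σ : Equiv.Perm α, ∀ a, g (σ a) = f a :=
  let e b : {a // f a = b} ≃ {a // g a = b} := (Finite.card_eq.1 (h b)).some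
  ⟨Equiv.ofFiberEquiv e, Equiv.ofFiberEquiv_map e⟩

open Classical in
theorem card_fiber_class_adj [Finite V] (v x : V) (P : Prop) :
    Nat.card {z // ((⟦z⟧ : Quotient E), T.Adj v z) = (⟦x⟧, P)} =
      if P then nbrCount T E v x else {z | E z x}.ncard - nbrCount T E v x := by
  have mem_iff (z : V) :
      ((⟦z⟧ : Quotient E), T.Adj v z) = (⟦x⟧, P) ↔ (T.Adj v z ↔ P) ∧ E z x := by
    rw [Prod.mk.injEq, Quotient.eq, eq_iff_iff, and_comm]
  rw [Nat.card_congr (Equiv.subtypeEquivRight mem_iff)]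
  split_ifs with hP
  · simp only [hP, iff_true]
    rfl
  · rw [nbrCount, Nat.card_coe_set_eq, ← Set.ncard_sdiff fun z hz => hz.2]
    simp only [hP, iff_false]
    refine Nat.card_congr (Equiv.subtypeEquivRight fun z => ?_)
    exact and_comm.trans (and_congr_right fun hz => not_congr (and_iff_left hz).symm)

theorem IsEquitable.exists_perm_map_nbrs [Finite V] (hE : IsEquitable T r E) {u v : V}
    (h : E u v) :
    ∃ χ : Equiv.Perm V, ∀ z, E (χ z) z ∧ (T.Adj v (χ z) ↔ T.Adj u z) := by
  have hcard : ∀ b : Quotient E × Prop,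
      Nat.card {z // ((⟦z⟧ : Quotient E), T.Adj u z) = b} =
        Nat.card {z // ((⟦z⟧ : Quotient E), T.Adj v z) = b} := by
    rintro ⟨⟨x⟩, P⟩
    exact (card_fiber_class_adj u x P).trans (hE.count h ▸ (card_fiber_class_adj v x P).symm)
  obtain ⟨χ, hχ⟩ := exists_perm_of_card_fiber_eq hcard
  exact ⟨χ, fun z => ⟨Quotient.exact (congrArg Prod.fst (hχ z)),
    iff_of_eq (congrArg Prod.snd (hχ z))⟩⟩

end Equitable

section RootedAut

variable {V : Type*} {T : SimpleGraph V} {r : V}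

/-- An action by maps that preserve adjacency and fix the root, as a homomorphism to the
automorphism group of the rooted tree. -/
def rootedAutHom {H : Type*} [Group H] (φ : H →* Function.End V) (hroot : ∀ h, φ h r = r)
    (hadj : ∀ h a b, T.Adj a b → T.Adj (φ h a) (φ h b)) : H →* RootedAut T r where
  toFun h :=
    ⟨{ toEquiv := φ.toHomPerm h
       map_rel_iff' := fun {a b} => ⟨fun hab => by
        have hinv : ∀ c, φ h⁻¹ (φ.toHomPerm h c) = c := (φ.toHomPerm h).symm_apply_apply
        simpa only [hinv] using hadj h⁻¹ _ _ hab, hadj h a b⟩ }, hroot h⟩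
  map_one' := Subtype.ext (RelIso.ext fun z => congrFun (map_one φ) z)
  map_mul' g h := Subtype.ext (RelIso.ext fun z => congrFun (map_mul φ g h) z)

end RootedAut

section Lift

variable {V : Type*} {T : SimpleGraph V} {r : V} {E : Setoid V}

/-- The permutations of the vertices that preserve every class and every set of siblings. They
serve as rules for permuting labels: `IsEquitable.lift` applies such a rule at all vertices
simultaneously. -/
def siblingPerm (T : SimpleGraph V) (r : V) (E : Setoid V) : Subgroup (Equiv.Perm V) where
  carrier := {σ | ∀ z, E (σ z) z ∧ parent T r (σ z) = parent T r z}
  one_mem' z := ⟨E.refl' z, rfl⟩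
  mul_mem' hσ hτ z :=
    ⟨E.trans' (hσ _).1 (hτ z).1, (hσ _).2.trans (hτ z).2⟩
  inv_mem' {σ} hσ z := by
    have h := hσ (σ.symm z)
    rw [σ.apply_symm_apply] at h
    exact ⟨E.symm' h.1, h.2.symm⟩

/-- The representative chosen for the class of `p`. -/
noncomputable def classRep (E : Setoid V) (p : V) : V := (⟦p⟧ : Quotient E).out

theorem classRep_rel (E : Setoid V) (p : V) : E (classRep E p) p :=
  Quotient.mk_out p

theorem classRep_eq {p q : V} (h : E p q) : classRep E p = classRep E q :=
  congrArg Quotient.out (Quotient.sound h)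

namespace IsEquitable

variable [Finite V]

/-- The neighbours of `p` are labelled by the neighbours of the chosen representative of the class
of `p`: the neighbour `z` gets the label `labelling p z`, in the same class as `z`. -/
noncomputable def labelling (hE : IsEquitable T r E) (p : V) : Equiv.Perm V :=
  (hE.exists_perm_map_nbrs (E.symm' (classRep_rel E p))).choose

theorem labelling_rel (hE : IsEquitable T r E) (p z : V) : E (hE.labelling p z) z :=
  ((hE.exists_perm_map_nbrs (E.symm' (classRep_rel E p))).choose_spec z).1

theorem adj_labelling_iff (hE : IsEquitable T r E) {p z : V} :
    T.Adj (classRep E p) (hE.labelling p z) ↔ T.Adj p z :=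
  ((hE.exists_perm_map_nbrs (E.symm' (classRep_rel E p))).choose_spec z).2

/-- A vertex of the rooted tree is determined by its address, the sequence of labels on the way from
the root; `lift hE σ` permutes the vertices by applying `σ` to each label of the address. -/
noncomputable def lift (hE : IsEquitable T r E) (σ : Equiv.Perm V) (z : V) : V :=
  if _h : T.dist r (parent T r z) < T.dist r z then
    (hE.labelling (lift hE σ (parent T r z))).symm (σ (hE.labelling (parent T r z) z))
  else z
termination_by T.dist r z

theorem lift_root (hE : IsEquitable T r E) (σ : Equiv.Perm V) : hE.lift σ r = r := by
  rw [lift, dif_neg (by simp)]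

theorem lift_of_ne (hE : IsEquitable T r E) (hT : T.IsTree) (σ : Equiv.Perm V) {z : V}
    (hz : z ≠ r) :
    hE.lift σ z =
      (hE.labelling (hE.lift σ (parent T r z))).symm (σ (hE.labelling (parent T r z) z)) := by
  have hd := dist_parent hT hz
  rw [lift, dif_pos (by omega)]

theorem labelling_lift (hE : IsEquitable T r E) (hT : T.IsTree) (σ : Equiv.Perm V) {z : V}
    (hz : z ≠ r) :
    hE.labelling (hE.lift σ (parent T r z)) (hE.lift σ z) =
      σ (hE.labelling (parent T r z) z) := by
  rw [hE.lift_of_ne hT σ hz, Equiv.apply_symm_apply]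

variable {σ τ : Equiv.Perm V}

theorem lift_rel (hE : IsEquitable T r E) (hT : T.IsTree) (hσ : σ ∈ siblingPerm T r E) (z : V) :
    E (hE.lift σ z) z := by
  by_cases hz : z = r
  · rw [hz, hE.lift_root]
  · refine E.trans' (E.symm' (hE.labelling_rel (hE.lift σ (parent T r z)) _)) ?_
    rw [hE.labelling_lift hT σ hz]
    exact E.trans' (hσ _).1 (hE.labelling_rel _ z)

theorem lift_ne_root (hE : IsEquitable T r E) (hT : T.IsTree) (hσ : σ ∈ siblingPerm T r E) {z : V}
    (hz : z ≠ r) : hE.lift σ z ≠ r :=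
  hE.ne_root hz (hE.lift_rel hT hσ z)

theorem parent_lift (hE : IsEquitable T r E) (hT : T.IsTree) (hσ : σ ∈ siblingPerm T r E) {z : V}
    (hz : z ≠ r) : parent T r (hE.lift σ z) = hE.lift σ (parent T r z) := by
  set p := parent T r z
  set ℓ := hE.labelling p z
  have hℓ : E ℓ z := hE.labelling_rel p z
  have hadj : T.Adj (classRep E p) ℓ := hE.adj_labelling_iff.2 (parent_adj hT hz)
  have hparent : parent T r (σ ℓ) = classRep E p :=
    (hσ ℓ).2.trans (hE.parent_eq_of_adj hT hz (classRep_rel E p) hadj hℓ)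
  refine hE.parent_eq_of_adj hT hz (hE.lift_rel hT hσ p) ?_ (hE.lift_rel hT hσ z)
  rw [← hE.adj_labelling_iff, hE.labelling_lift hT σ hz, classRep_eq (hE.lift_rel hT hσ p),
    ← hparent]
  exact parent_adj hT (hE.ne_root hz (E.trans' (hσ ℓ).1 hℓ))

theorem lift_one (hE : IsEquitable T r E) (hT : T.IsTree) (z : V) : hE.lift 1 z = z := by
  induction z using rootedTree_induction hT (r := r) with
  | root => exact hE.lift_root 1
  | step z hz ih => rw [hE.lift_of_ne hT 1 hz, ih, Equiv.Perm.one_apply, Equiv.symm_apply_apply]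

theorem lift_mul (hE : IsEquitable T r E) (hT : T.IsTree) (hτ : τ ∈ siblingPerm T r E) (z : V) :
    hE.lift (σ * τ) z = hE.lift σ (hE.lift τ z) := by
  induction z using rootedTree_induction hT (r := r) with
  | root => simp only [lift_root]
  | step z hz ih =>
    rw [hE.lift_of_ne hT _ hz, ih, hE.lift_of_ne hT σ (hE.lift_ne_root hT hτ hz),
      hE.parent_lift hT hτ hz, hE.labelling_lift hT τ hz, Equiv.Perm.mul_apply]

theorem lift_adj (hE : IsEquitable T r E) (hT : T.IsTree) (hσ : σ ∈ siblingPerm T r E) {a b : V}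
    (h : T.Adj a b) : T.Adj (hE.lift σ a) (hE.lift σ b) := by
  have adj_lift_parent {z : V} (hz : z ≠ r) :
      T.Adj (hE.lift σ (parent T r z)) (hE.lift σ z) := by
    rw [← hE.parent_lift hT hσ hz]
    exact parent_adj hT (hE.lift_ne_root hT hσ hz)
  obtain ⟨hb, rfl⟩ | ⟨ha, rfl⟩ := parent_eq_or_parent_eq (r := r) hT h
  · exact adj_lift_parent hb
  · exact (adj_lift_parent ha).symm

/-- The lift of sibling permutations as a homomorphism. -/
noncomputable def liftHom (hE : IsEquitable T r E) (hT : T.IsTree) :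
    siblingPerm T r E →* RootedAut T r :=
  rootedAutHom
    { toFun σ := hE.lift σ
      map_one' := funext (hE.lift_one hT)
      map_mul' _ τ := funext (hE.lift_mul hT τ.2) }
    (fun σ => hE.lift_root σ) (fun σ _ _ h => hE.lift_adj hT σ.2 h)

theorem apply_labelling_of_lift_eq (hE : IsEquitable T r E) (hT : T.IsTree)
    (h : ∀ z, hE.lift σ z = z) {z : V} (hz : z ≠ r) :
    σ (hE.labelling (parent T r z) z) = hE.labelling (parent T r z) z := by
  rw [← hE.labelling_lift hT σ hz, h, h]

end IsEquitable

end Lift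

section Criterion

variable {V : Type*} {T : SimpleGraph V} {r : V} {E : Setoid V} {G : Type*} [Group G]

theorem hasNontrivialPermRep_card_iff {α : Type*} [Finite α] :
    HasNontrivialPermRep G (Nat.card α) ↔ ∃ ρ : G →* Equiv.Perm α, ∃ g, ρ g ≠ 1 := by
  have e : Equiv.Perm α ≃* Equiv.Perm (Fin (Nat.card α)) := (Finite.equivFin α).permCongrHom
  constructor
  · rintro ⟨ρ, g, hg⟩
    exact ⟨(e.symm : _ →* _).comp ρ, g, (map_ne_one_iff e.symm e.symm.injective).2 hg⟩
  · rintro ⟨ρ, g, hg⟩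
    exact ⟨(e : _ →* _).comp ρ, g, (map_ne_one_iff e e.injective).2 hg⟩

section OfPermRep

variable [Finite V]

open Classical in
theorem IsEquitable.ofSubtype_mem_siblingPerm (hE : IsEquitable T r E) (hT : T.IsTree) {v x : V}
    (σ : Equiv.Perm (nbrClass T E v x)) : Equiv.Perm.ofSubtype σ ∈ siblingPerm T r E := by
  intro z
  by_cases hz : z ∈ nbrClass T E v x
  · rw [Equiv.Perm.ofSubtype_apply_of_mem σ hz]
    set z' := σ ⟨z, hz⟩
    have hrel : E z' z := E.trans' z'.2.2 (E.symm' hz.2)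
    refine ⟨hrel, ?_⟩
    by_cases hne : (z' : V) = z
    · rw [hne]
    · rw [(hE.ne_root_and_parent_eq_of_ne hT z'.2.1 hz.1 hrel hne).2,
        (hE.ne_root_and_parent_eq_of_ne hT hz.1 z'.2.1 (E.symm' hrel) (Ne.symm hne)).2]
  · rw [Equiv.Perm.ofSubtype_apply_of_not_mem σ hz]
    exact ⟨E.refl' z, rfl⟩

open Classical in
/-- A permutation of the neighbours of `v` in one class, extended by the identity to a rule for
permuting labels. -/
noncomputable def IsEquitable.nbrClassHom (hE : IsEquitable T r E) (hT : T.IsTree) (v x : V) :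
    Equiv.Perm (nbrClass T E v x) →* siblingPerm T r E :=
  Equiv.Perm.ofSubtype.codRestrict _ (hE.ofSubtype_mem_siblingPerm hT)

theorem IsEquitable.nbrClassHom_apply (hE : IsEquitable T r E) (hT : T.IsTree) {v x : V}
    (σ : Equiv.Perm (nbrClass T E v x)) (y : nbrClass T E v x) :
    (hE.nbrClassHom hT v x σ : Equiv.Perm V) y = σ y := by
  classical exact Equiv.Perm.ofSubtype_apply_coe σ y

theorem IsEquitable.eq_one_of_liftHom_eq_one (hE : IsEquitable T r E) (hT : T.IsTree) {v x : V}
    {σ : Equiv.Perm (nbrClass T E (classRep E v) x)}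
    (h : hE.liftHom hT (hE.nbrClassHom hT _ x σ) = 1) : σ = 1 := by
  refine Equiv.ext fun y => by_contra fun hne => hne ?_
  obtain ⟨z, hz⟩ := (hE.labelling v).surjective y
  obtain ⟨z', hz'⟩ := (hE.labelling v).surjective (σ y)
  have adj {z : V} {y : nbrClass T E (classRep E v) x} (hz : hE.labelling v z = y) : T.Adj v z :=
    hE.adj_labelling_iff.1 (hz ▸ y.2.1)
  have rel {z : V} {y : nbrClass T E (classRep E v) x} (hz : hE.labelling v z = y) : E z x :=
    E.trans' (E.symm' (hE.labelling_rel v z)) (hz ▸ y.2.2)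
  have hzz' : z ≠ z' := by
    rintro rfl
    exact hne (Subtype.ext (hz'.symm.trans hz))
  have hrel : E z z' := E.trans' (rel hz) (E.symm' (rel hz'))
  obtain ⟨hr, rfl⟩ := hE.ne_root_and_parent_eq_of_ne hT (adj hz) (adj hz') hrel hzz'
  have hlift (z : V) : hE.lift (hE.nbrClassHom hT _ x σ : Equiv.Perm V) z = z :=
    DFunLike.congr_fun (congrArg Subtype.val h) z
  have hfix := hE.apply_labelling_of_lift_eq hT hlift hr
  rw [hz, hE.nbrClassHom_apply] at hfix
  exact Subtype.ext hfix

theorem IsEquitable.representableOn (hE : IsEquitable T r E) (hT : T.IsTree) {v x : V}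
    (h : HasNontrivialPermRep G (nbrCount T E v x)) : RepresentableOn G T r := by
  rw [← hE.count (classRep_rel E v), nbrCount, hasNontrivialPermRep_card_iff] at h
  obtain ⟨ρ, g, hg⟩ := h
  exact ⟨((hE.liftHom hT).comp (hE.nbrClassHom hT _ x)).comp ρ, g,
    fun h => hg (hE.eq_one_of_liftHom_eq_one hT h)⟩

end OfPermRep

theorem exists_moved_of_fixed_parent (hT : T.IsTree) {ρ : G →* RootedAut T r} (hρ : ∃ g, ρ g ≠ 1) :
    ∃ x ≠ r, (∀ g, (ρ g).1 (parent T r x) = parent T r x) ∧ ∃ g, (ρ g).1 x ≠ x := by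
  by_contra! hfix
  obtain ⟨g, hg⟩ := hρ
  have fixed (z : V) : ∀ g, (ρ g).1 z = z := by
    induction z using rootedTree_induction hT (r := r) with
    | root => exact fun g => (ρ g).2
    | step z hz ih => exact hfix z hz ih
  exact hg (Subtype.ext (RelIso.ext fun z => fixed z g))

/-- The action on a set of siblings of a group of automorphisms that fixes their parent. -/
def siblingHom (ρ : G →* RootedAut T r) (hE : ∀ φ ∈ RootedAut T r, ∀ u, E (φ u) u) {v : V}
    (hv : ∀ g, (ρ g).1 v = v) (x : V) : G →* Equiv.Perm (nbrClass T E v x) where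
  toFun g := Equiv.Perm.subtypePerm (ρ g).1.toEquiv fun y => by
    have h := map_mem_nbrClass_iff (hE _ (ρ g).2) (v := v) (x := x) (y := y)
    rwa [hv] at h
  map_one' := Equiv.ext fun y => Subtype.ext (by simp only [map_one]; rfl)
  map_mul' g h := Equiv.ext fun y => Subtype.ext (by simp only [map_mul]; rfl)

theorem exists_hasNontrivialPermRep_nbrCount [Finite V] (hT : T.IsTree)
    (hE : ∀ φ ∈ RootedAut T r, ∀ u, E (φ u) u) (h : RepresentableOn G T r) :
    ∃ v x, T.Adj v x ∧ HasNontrivialPermRep G (nbrCount T E v x) := by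
  obtain ⟨ρ, hρ⟩ := h
  obtain ⟨x, hx, hparent, g, hg⟩ := exists_moved_of_fixed_parent hT hρ
  have hadj := parent_adj hT hx
  refine ⟨parent T r x, x, hadj, hasNontrivialPermRep_card_iff.2
    ⟨siblingHom ρ hE hparent x, g, fun h1 => hg ?_⟩⟩
  exact congrArg Subtype.val (Equiv.congr_fun h1 ⟨x, hadj, E.refl' x⟩)

theorem representableOn_iff [Finite V] (hT : T.IsTree) :
    RepresentableOn G T r ↔ ∃ v x, T.Adj v x ∧ HasNontrivialPermRep G
      (nbrCount T (colourRefinement T r (Nat.card V)) v x) :=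
  ⟨exists_hasNontrivialPermRep_nbrCount hT fun _ hφ => colourRefinement_map hφ _,
    fun ⟨_, _, _, h⟩ => (isEquitable_colourRefinement T r).representableOn hT h⟩

end Criterion

end GroupRep

namespace OracleRAM

open Set (EqOn Iio)
open Matrix (vecCons)

section Store

variable (s : Store) (x i a v : ℕ)

@[simp]
theorem Store.setReg_reg (y : ℕ) : (s.setReg x v).reg y = if y = x then v else s.reg y :=
  Function.update_apply _ _ _ _

@[simp]
theorem Store.setArr_arr_self (j : ℕ) :
    (s.setArr a i v).arr a j = if j = i then v else s.arr a j := by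
  simp [Store.setArr, Function.update_apply]

theorem Store.setArr_arr_of_ne {b : ℕ} (h : b ≠ a) : (s.setArr a i v).arr b = s.arr b :=
  Function.update_of_ne h _ _

theorem Store.eqOn_setReg {K : ℕ} (h : K ≤ x) : EqOn (s.setReg x v).reg s.reg (Iio K) :=
  fun _ hy => Function.update_of_ne (lt_of_lt_of_le hy h).ne _ _

end Store

/-- Total correctness with a time bound: started in `s`, the program `P` halts after at most `c`
steps in a store that satisfies `Q`. -/
def HaltsWithin (O : ℕ → Bool) (P : Program) (c : ℕ) (Q : Store → Prop) (s : Store) : Prop :=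
  ∃ t s', Run O P s t s' ∧ t ≤ c ∧ Q s'

namespace HaltsWithin

variable {O : ℕ → Bool} {p q : Program} {c d : ℕ} {Q Q' : Store → Prop} {s : Store}

theorem mono (h : HaltsWithin O p c Q s) (hcd : c ≤ d) (hQ : ∀ s', Q s' → Q' s') :
    HaltsWithin O p d Q' s :=
  let ⟨t, s', hrun, ht, hs'⟩ := h
  ⟨t, s', hrun, ht.trans hcd, hQ s' hs'⟩

theorem of_run_one {s' : Store} (h : Run O p s 1 s') (hs' : Q s') : HaltsWithin O p 1 Q s :=
  ⟨1, s', h, le_rfl, hs'⟩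

theorem seq (h : HaltsWithin O p c (HaltsWithin O q d Q) s) :
    HaltsWithin O (.seq p q) (c + d) Q s :=
  let ⟨_, _, hrun, ht, _, s'', hrun', ht', hs''⟩ := h
  ⟨_, s'', .seq hrun hrun', Nat.add_le_add ht ht', hs''⟩

theorem cond {x : ℕ} (hp : s.reg x ≠ 0 → HaltsWithin O p c Q s)
    (hq : s.reg x = 0 → HaltsWithin O q c Q s) : HaltsWithin O (.cond x p q) (c + 1) Q s := by
  by_cases hx : s.reg x = 0
  · obtain ⟨t, s', hrun, ht, hs'⟩ := hq hx
    exact ⟨t + 1, s', .cond_false hx hrun, Nat.succ_le_succ ht, hs'⟩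
  · obtain ⟨t, s', hrun, ht, hs'⟩ := hp hx
    exact ⟨t + 1, s', .cond_true hx hrun, Nat.succ_le_succ ht, hs'⟩

theorem loop {x : ℕ} {I : ℕ → Store → Prop} (hx : ∀ m s, I m s → s.reg x = m)
    (hbody : ∀ m s, I (m + 1) s → HaltsWithin O p c (I m) s) {m : ℕ} (h : I m s) :
    HaltsWithin O (.loop x p) (m * (c + 1) + 1) (I 0) s := by
  induction m generalizing s with
  | zero => exact of_run_one (.loop_done (hx 0 s h)) h |>.mono (by omega) fun _ => id
  | succ m ih =>
    obtain ⟨t, s', hrun, ht, hs'⟩ := hbody m s h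
    obtain ⟨t', s'', hrun', ht', hs''⟩ := ih hs'
    have hne : s.reg x ≠ 0 := (hx _ s h).trans_ne m.succ_ne_zero
    refine ⟨_, s'', .loop_step hne hrun hrun', ?_, hs''⟩
    linarith

end HaltsWithin

/-- The program `x := y`, for `x ≠ y`. -/
def move (x y : ℕ) : Program := .seq (.const x 0) (.add x x y)

theorem haltsWithin_move {O : ℕ → Bool} {x y : ℕ} (hxy : y ≠ x) {Q : Store → Prop} {s : Store}
    (h : Q ((s.setReg x 0).setReg x (s.reg y))) : HaltsWithin O (move x y) 2 Q s :=
  .seq (.of_run_one (.const _ _ _) (.of_run_one (.add _ _ _ _) (by simpa [hxy] using h)))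

/-- Repeat `body` for all values of register `i` below the value of register `1`. The registers
`i + 1` and `i + 2` hold the number of remaining rounds and the constant `1`. -/
def forLoop (i : ℕ) (body : Program) : Program :=
  .seq (.const i 0) (.seq (move (i + 1) 1) (.seq (.const (i + 2) 1)
    (.loop (i + 1) (.seq body (.seq (.add i i (i + 2)) (.sub (i + 1) (i + 1) (i + 2)))))))

/-- The loop invariant of `forLoop i body`, started in `s`, when `m` of the `n` rounds remain. The
predicate `I j` describes the effect of the first `j` rounds. -/
structure LoopInvariant (i n : ℕ) (I : ℕ → Store → Prop) (s : Store) (m : ℕ) (s' : Store) :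
    Prop where
  remaining : s'.reg (i + 1) = m
  one : s'.reg (i + 2) = 1
  counter : s'.reg i + m = n
  eqOn : EqOn s'.reg s.reg (Iio i)
  inv : I (s'.reg i) s'

section ForLoop

variable {O : ℕ → Bool} {i c n : ℕ} {body : Program} {s : Store} {I : ℕ → Store → Prop}

theorem LoopInvariant.start (hI : ∀ {j s x v}, x < i + 3 → I j s → I j (s.setReg x v))
    (h0 : I 0 s) : LoopInvariant i n I s n
      ((((s.setReg i 0).setReg (i + 1) 0).setReg (i + 1) n).setReg (i + 2) 1) where
  remaining := by simp
  one := by simp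
  counter := by simp
  eqOn x hx := by
    have : x < i := hx
    simp [show x ≠ i by omega, show x ≠ i + 1 by omega, show x ≠ i + 2 by omega]
  inv := by
    simpa using hI (by omega) (hI (by omega) (hI (by omega) (hI (by omega) h0)))

theorem LoopInvariant.next (hI : ∀ {j s x v}, x < i + 3 → I j s → I j (s.setReg x v)) {m : ℕ}
    {s' s'' : Store} (h : LoopInvariant i n I s (m + 1) s')
    (heq : EqOn s''.reg s'.reg (Iio (i + 3))) (hs'' : I (s'.reg i + 1) s'') :
    LoopInvariant i n I s m ((s''.setReg i (s'.reg i + 1)).setReg (i + 1) m) where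
  remaining := by simp
  one := by simpa using (heq (by simp)).trans h.one
  counter := by simpa using (by linarith [h.counter] : s'.reg i + 1 + m = n)
  eqOn := (Store.eqOn_setReg _ _ _ i.le_succ).trans ((Store.eqOn_setReg _ _ _ le_rfl).trans
    ((heq.mono (Set.Iio_subset_Iio (by omega))).trans h.eqOn))
  inv := by simpa using hI (by omega) (hI (by omega) hs'')

theorem haltsWithin_forLoop (hi : 1 < i) (hn : s.reg 1 = n)
    (hI : ∀ {j s x v}, x < i + 3 → I j s → I j (s.setReg x v))
    (hbody : ∀ j < n, ∀ s', EqOn s'.reg s.reg (Iio i) → s'.reg i = j → I j s' →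
      HaltsWithin O body c (fun s'' => EqOn s''.reg s'.reg (Iio (i + 3)) ∧ I (j + 1) s'') s')
    (h0 : I 0 s) :
    HaltsWithin O (forLoop i body) (n * (c + 3) + 5)
      (fun s' => EqOn s'.reg s.reg (Iio i) ∧ I n s') s := by
  have hround (m : ℕ) (s' : Store) (h : LoopInvariant i n I s (m + 1) s') :
      HaltsWithin O (.seq body (.seq (.add i i (i + 2)) (.sub (i + 1) (i + 1) (i + 2))))
        (c + (1 + 1)) (LoopInvariant i n I s m) s' := by
    have hlt : s'.reg i < n := by linarith [h.counter]
    refine .seq ((hbody _ hlt s' h.eqOn rfl h.inv).mono le_rfl fun s'' ⟨heq, hs''⟩ =>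
      .seq (.of_run_one (.add _ _ _ _) (.of_run_one (.sub _ _ _ _) ?_)))
    have hreg (x : ℕ) (hx : x < i + 3) : s''.reg x = s'.reg x := heq hx
    simpa [hreg, h.one, h.remaining] using h.next hI heq hs''
  have hfinal (s' : Store) (h : LoopInvariant i n I s 0 s') :
      EqOn s'.reg s.reg (Iio i) ∧ I n s' :=
    ⟨h.eqOn, h.counter ▸ h.inv⟩
  have hloop := (HaltsWithin.loop (fun _ _ h => h.remaining) hround (.start hI h0)).mono le_rfl
    hfinal
  have hone : (s.setReg i 0).reg 1 = n := by simp [hi.ne, hn]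
  refine HaltsWithin.mono (c := 1 + (2 + (1 + (n * (c + (1 + 1) + 1) + 1)))) ?_ (by linarith)
    fun _ => id
  exact .seq (.of_run_one (.const _ _ _) (.seq (haltsWithin_move (by omega)
    (.seq (.of_run_one (.const _ _ _) (hone ▸ hloop))))))

end ForLoop

/-- The registers below `K` and all arrays hold the same values in `s'` as in `s`. -/
def Unchanged (K : ℕ) (s s' : Store) : Prop :=
  EqOn s'.reg s.reg (Iio K) ∧ s'.arr = s.arr

namespace Unchanged

variable {K L : ℕ} {s s' s'' : Store}

theorem refl (K : ℕ) (s : Store) : Unchanged K s s :=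
  ⟨fun _ _ => rfl, rfl⟩

theorem trans (h : Unchanged K s s') (h' : Unchanged K s' s'') : Unchanged K s s'' :=
  ⟨h'.1.trans h.1, h'.2.trans h.2⟩

theorem mono (h : Unchanged L s s') (hKL : K ≤ L) : Unchanged K s s' :=
  ⟨h.1.mono (Set.Iio_subset_Iio hKL), h.2⟩

theorem setReg (h : Unchanged K s s') {x v : ℕ} (hx : K ≤ x) : Unchanged K s (s'.setReg x v) :=
  ⟨(s'.eqOn_setReg x v hx).trans h.1, h.2⟩

end Unchanged

/-- Arithmetic expressions in `k` variables. They have access to arrays and to an oracle, and are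
evaluated in a context that fixes a number `n`: the variable bound by `sum` runs over the numbers
below `n`. -/
inductive Exp : ℕ → Type
  | var {k : ℕ} (i : Fin k) : Exp k
  | const {k : ℕ} (c : ℕ) : Exp k
  | add {k : ℕ} (e₁ e₂ : Exp k) : Exp k
  | sub {k : ℕ} (e₁ e₂ : Exp k) : Exp k
  | load {k : ℕ} (a : ℕ) (e : Exp k) : Exp k
  | query {k : ℕ} (e : Exp k) : Exp k
  | ite {k : ℕ} (e e₁ e₂ : Exp k) : Exp k
  | sum {k : ℕ} (e : Exp (k + 1)) : Exp k

namespace Exp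

/-- The value of an expression, for the oracle `O`, the range `n` of bound variables, the contents
`A` of the arrays and the values `env` of the variables. -/
def eval (O : ℕ → Bool) (n : ℕ) (A : ℕ → ℕ → ℕ) {k : ℕ} : Exp k → (Fin k → ℕ) → ℕ
  | var i, env => env i
  | const c, _ => c
  | add e₁ e₂, env => e₁.eval O n A env + e₂.eval O n A env
  | sub e₁ e₂, env => e₁.eval O n A env - e₂.eval O n A env
  | load a e, env => A a (e.eval O n A env)
  | query e, env => if O (e.eval O n A env) = true then 1 else 0
  | ite e e₁ e₂, env => if e.eval O n A env ≠ 0 then e₁.eval O n A env else e₂.eval O n A env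
  | sum e, env => ∑ i ∈ Finset.range n, e.eval O n A (vecCons i env)

/-- A program that computes the value of an expression in register `K`, provided that register `1`
holds the range of bound variables and the variables are in the registers `ρ`, all of them below
`K`. It changes no register below `K`. -/
def compile {k : ℕ} : Exp k → (Fin k → ℕ) → ℕ → Program
  | var i, ρ, K => move K (ρ i)
  | const c, _, K => .const K c
  | add e₁ e₂, ρ, K => .seq (e₁.compile ρ K) (.seq (e₂.compile ρ (K + 1)) (.add K K (K + 1)))
  | sub e₁ e₂, ρ, K => .seq (e₁.compile ρ K) (.seq (e₂.compile ρ (K + 1)) (.sub K K (K + 1)))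
  | load a e, ρ, K => .seq (e.compile ρ K) (.load K a K)
  | query e, ρ, K => .seq (e.compile ρ K) (.query K K)
  | ite e e₁ e₂, ρ, K => .seq (e.compile ρ K) (.cond K (e₁.compile ρ K) (e₂.compile ρ K))
  | sum e, ρ, K => .seq (.const (K + 3) 0) (.seq
      (forLoop K (.seq (e.compile (vecCons K ρ) (K + 4)) (.add (K + 3) (K + 3) (K + 4))))
      (move K (K + 3)))

end Exp

/-- A bound for the running time of a loop over all numbers below `n`, as a polynomial in `n`, if
`p` is one for a single round. -/
noncomputable def loopCost (p : Polynomial ℕ) : Polynomial ℕ := .X * (p + 3) + 5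

theorem eval_loopCost (p : Polynomial ℕ) (n : ℕ) :
    (loopCost p).eval n = n * (p.eval n + 3) + 5 := by
  simp [loopCost]

namespace Exp

/-- A bound for the running time of `compile`, as a polynomial in the range of bound variables. -/
noncomputable def cost {k : ℕ} : Exp k → Polynomial ℕ
  | var _ => 2
  | const _ => 1
  | add e₁ e₂ => e₁.cost + (e₂.cost + 1)
  | sub e₁ e₂ => e₁.cost + (e₂.cost + 1)
  | load _ e => e.cost + 1
  | query e => e.cost + 1
  | ite e e₁ e₂ => e.cost + (e₁.cost + e₂.cost + 1)
  | sum e => 1 + (loopCost (e.cost + 1) + 2)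

end Exp

/-- The store `s` provides the context for code that works with the registers from `K` on:
register `1` holds `n`, the arrays hold `A`, and the registers `ρ` hold the values `env` of the
variables. -/
structure Frame (n : ℕ) (A : ℕ → ℕ → ℕ) {k : ℕ} (ρ env : Fin k → ℕ) (K : ℕ) (s : Store) :
    Prop where
  one_lt : 1 < K
  lt : ∀ i, ρ i < K
  size : s.reg 1 = n
  arr : s.arr = A
  var : ∀ i, s.reg (ρ i) = env i

namespace Frame

variable {n k K L : ℕ} {A : ℕ → ℕ → ℕ} {ρ env : Fin k → ℕ} {s s' : Store}

theorem congr (h : Frame n A ρ env K s) (hreg : EqOn s'.reg s.reg (Iio K)) {A' : ℕ → ℕ → ℕ}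
    (harr : s'.arr = A') : Frame n A' ρ env K s' where
  one_lt := h.one_lt
  lt := h.lt
  size := (hreg h.one_lt).trans h.size
  arr := harr
  var i := (hreg (h.lt i)).trans (h.var i)

theorem unchanged (h : Frame n A ρ env K s) (hs : Unchanged K s s') : Frame n A ρ env K s' :=
  h.congr hs.1 (hs.2.trans h.arr)

theorem mono (h : Frame n A ρ env K s) (hKL : K ≤ L) : Frame n A ρ env L s where
  one_lt := h.one_lt.trans_le hKL
  lt i := (h.lt i).trans_le hKL
  size := h.size
  arr := h.arr
  var := h.var

theorem cons (h : Frame n A ρ env K s) (hKL : K < L) {j : ℕ} (hj : s.reg K = j) :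
    Frame n A (vecCons K ρ) (vecCons j env) L s where
  one_lt := h.one_lt.trans hKL
  lt := Fin.cases hKL fun i => (h.lt i).trans hKL
  size := h.size
  arr := h.arr
  var := Fin.cases hj h.var

end Frame

/-- The program `P` computes `v` in register `K`, in at most `c` steps, and changes no register
below `K` and no array. -/
def Computes (O : ℕ → Bool) (P : Program) (c K v : ℕ) (s : Store) : Prop :=
  HaltsWithin O P c (fun s' => s'.reg K = v ∧ Unchanged K s s') s

namespace Computes

variable {O : ℕ → Bool} {p q : Program} {c d K v w z : ℕ} {s : Store}

theorem of_run_one (h : Run O p s 1 (s.setReg K v)) : Computes O p 1 K v s :=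
  HaltsWithin.of_run_one h ⟨by simp, (Unchanged.refl K s).setReg le_rfl⟩

theorem seq (hp : Computes O p c K v s)
    (hq : ∀ s', s'.reg K = v → Unchanged K s s' → Computes O q d K w s') :
    Computes O (.seq p q) (c + d) K w s :=
  HaltsWithin.seq (hp.mono le_rfl fun s' hs' =>
    (hq s' hs'.1 hs'.2).mono le_rfl fun _ hs'' => ⟨hs''.1, hs'.2.trans hs''.2⟩)

theorem cond (hv : s.reg K = v) (hp : Computes O p c K w s) (hq : Computes O q d K z s) :
    Computes O (.cond K p q) (c + d + 1) K (if v ≠ 0 then w else z) s := by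
  subst hv
  refine HaltsWithin.cond (fun h => ?_) (fun h => ?_)
  · rw [if_pos h]
    exact hp.mono (Nat.le_add_right _ _) fun _ => id
  · rw [if_neg (not_not.2 h)]
    exact hq.mono (Nat.le_add_left _ _) fun _ => id

theorem binary {op : Program} (hp : Computes O p c K v s)
    (hq : ∀ s', Unchanged K s s' → Computes O q d (K + 1) w s')
    (hop : ∀ s', s'.reg K = v → s'.reg (K + 1) = w → Run O op s' 1 (s'.setReg K z)) :
    Computes O (.seq p (.seq q op)) (c + (d + 1)) K z s :=
  hp.seq fun s' hv hs' => HaltsWithin.seq ((hq s' hs').mono le_rfl fun s'' hs'' =>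
    have hv' : s''.reg K = v := (hs''.2.1 K.lt_succ_self).trans hv
    HaltsWithin.of_run_one (hop s'' hv' hs''.1)
      ⟨by simp, (hs''.2.mono K.le_succ).setReg le_rfl⟩)

theorem move {x : ℕ} (hx : x ≠ K) : Computes O (move K x) 2 K (s.reg x) s :=
  haltsWithin_move hx ⟨by simp, ((Unchanged.refl K s).setReg le_rfl).setReg le_rfl⟩

end Computes

section Sum

variable {O : ℕ → Bool} {p : Program} {n c k K : ℕ} {A : ℕ → ℕ → ℕ} {ρ env : Fin k → ℕ} {s : Store}
  {f : ℕ → ℕ}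

theorem haltsWithin_accumulate (h : Frame n A ρ env K s) (hacc : s.reg (K + 3) = 0)
    (hp : ∀ j s', Frame n A (vecCons K ρ) (vecCons j env) (K + 4) s' →
      Computes O p c (K + 4) (f j) s') :
    HaltsWithin O (forLoop K (.seq p (.add (K + 3) (K + 3) (K + 4)))) (n * (c + 1 + 3) + 5)
      (fun s' => s'.reg (K + 3) = ∑ j ∈ Finset.range n, f j ∧ Unchanged K s s') s := by
  let I : ℕ → Store → Prop := fun j s' =>
    s'.reg (K + 3) = ∑ i ∈ Finset.range j, f i ∧ s'.arr = A
  have hI {j s' x v} (hx : x < K + 3) (hs' : I j s') : I j (s'.setReg x v) :=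
    ⟨by simp [hx.ne', hs'.1], hs'.2⟩
  refine (haltsWithin_forLoop (I := I) h.one_lt h.size hI ?_ ⟨hacc, h.arr⟩).mono le_rfl
    fun s' ⟨heq, hsum, harr⟩ => ⟨hsum, heq, harr.trans h.arr.symm⟩
  intro j _ s' heq hj ⟨hsum, harr⟩
  have hframe := (h.congr heq harr).cons (L := K + 4) (by omega) hj
  refine .seq ((hp j s' hframe).mono le_rfl fun s'' ⟨hf, hs''⟩ => .of_run_one (.add _ _ _ _) ?_)
  have hacc' : s''.reg (K + 3) = ∑ i ∈ Finset.range j, f i :=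
    (hs''.1 (K + 3).lt_succ_self).trans hsum
  have hunch := (hs''.mono (K + 3).le_succ).setReg (le_refl (K + 3))
    (v := s''.reg (K + 3) + s''.reg (K + 4))
  exact ⟨hunch.1, by simp [hacc', hf, Finset.sum_range_succ], hunch.2.trans harr⟩

theorem computes_sum (h : Frame n A ρ env K s)
    (hp : ∀ j s', Frame n A (vecCons K ρ) (vecCons j env) (K + 4) s' →
      Computes O p c (K + 4) (f j) s') :
    Computes O (.seq (.const (K + 3) 0)
      (.seq (forLoop K (.seq p (.add (K + 3) (K + 3) (K + 4)))) (move K (K + 3))))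
      (1 + (n * (c + 1 + 3) + 5 + 2)) K (∑ j ∈ Finset.range n, f j) s := by
  have hs₀ : Unchanged K s (s.setReg (K + 3) 0) := (Unchanged.refl K s).setReg (by omega)
  refine HaltsWithin.seq (.of_run_one (.const _ _ _) (.seq
    ((haltsWithin_accumulate (h.unchanged hs₀) (by simp) hp).mono le_rfl fun s' hs' => ?_)))
  rw [← hs'.1]
  exact (Computes.move (by omega)).mono le_rfl fun s'' hs'' =>
    ⟨hs''.1, hs₀.trans (hs'.2.trans hs''.2)⟩

end Sum

theorem Exp.computes {O : ℕ → Bool} {n : ℕ} {A : ℕ → ℕ → ℕ} {k : ℕ} (e : Exp k)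
    {ρ env : Fin k → ℕ} {K : ℕ} {s : Store} (h : Frame n A ρ env K s) :
    Computes O (e.compile ρ K) (e.cost.eval n) K (e.eval O n A env) s := by
  induction e generalizing K s with
  | var i =>
    rw [cost, Polynomial.eval_ofNat, eval, ← h.var i]
    exact .move (h.lt i).ne
  | const c =>
    rw [cost, Polynomial.eval_one]
    exact .of_run_one (.const _ _ _)
  | add e₁ e₂ ih₁ ih₂ =>
    simp only [cost, eval, Polynomial.eval_add, Polynomial.eval_one]
    exact (ih₁ h).binary (fun _ hs' => ih₂ ((h.unchanged hs').mono K.le_succ))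
      fun s' h₁ h₂ => h₁ ▸ h₂ ▸ .add _ _ _ _
  | sub e₁ e₂ ih₁ ih₂ =>
    simp only [cost, eval, Polynomial.eval_add, Polynomial.eval_one]
    exact (ih₁ h).binary (fun _ hs' => ih₂ ((h.unchanged hs').mono K.le_succ))
      fun s' h₁ h₂ => h₁ ▸ h₂ ▸ .sub _ _ _ _
  | load a e ih =>
    simp only [cost, eval, Polynomial.eval_add, Polynomial.eval_one]
    exact (ih h).seq fun s' hv hs' =>
      .of_run_one (hv ▸ (h.unchanged hs').arr ▸ .load _ _ _ _)
  | query e ih =>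
    simp only [cost, eval, Polynomial.eval_add, Polynomial.eval_one]
    exact (ih h).seq fun s' hv _ => .of_run_one (hv ▸ .query _ _ _)
  | ite e e₁ e₂ ih ih₁ ih₂ =>
    simp only [cost, eval, Polynomial.eval_add, Polynomial.eval_one]
    exact (ih h).seq fun s' hv hs' => .cond hv (ih₁ (h.unchanged hs')) (ih₂ (h.unchanged hs'))
  | sum e ih =>
    simp only [cost, eval, eval_loopCost, Polynomial.eval_add, Polynomial.eval_one,
      Polynomial.eval_ofNat]
    exact computes_sum h fun j s' hs' => ih hs'

namespace Exp

variable {O : ℕ → Bool} {n : ℕ} {A : ℕ → ℕ → ℕ} {k : ℕ} {env : Fin k → ℕ}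

/-- `1` if `e` is `0`, otherwise `0`. -/
def isZero (e : Exp k) : Exp k := sub (const 1) e

/-- A nonzero number if and only if `e₁` and `e₂` are different. -/
def ne (e₁ e₂ : Exp k) : Exp k := add (sub e₁ e₂) (sub e₂ e₁)

/-- `1` if `e₁` and `e₂` are equal, otherwise `0`. -/
def eq (e₁ e₂ : Exp k) : Exp k := isZero (ne e₁ e₂)

/-- The value of `e₂` if `e₁` is not `0`, otherwise `0`. -/
def and (e₁ e₂ : Exp k) : Exp k := ite e₁ e₂ (const 0)

/-- The index of row `u`, column `v` in a table with `n` columns. -/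
def cellIndex (u v : Fin k) : Exp k := add (var v) (sum (var u.succ))

/-- The entry in row `u`, column `v` of the table in array `a`. -/
def entry (a : ℕ) (u v : Fin k) : Exp k := load a (cellIndex u v)

theorem eval_isZero (e : Exp k) :
    (isZero e).eval O n A env = if e.eval O n A env = 0 then 1 else 0 := by
  simp only [isZero, eval]
  split_ifs <;> omega

theorem eval_ne_eq_zero_iff {e₁ e₂ : Exp k} :
    (ne e₁ e₂).eval O n A env = 0 ↔ e₁.eval O n A env = e₂.eval O n A env := by
  simp only [ne, eval]
  omega

theorem eval_eq (e₁ e₂ : Exp k) :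
    (eq e₁ e₂).eval O n A env = if e₁.eval O n A env = e₂.eval O n A env then 1 else 0 := by
  simp only [eq, eval_isZero, eval_ne_eq_zero_iff]

theorem eval_and (e₁ e₂ : Exp k) :
    (and e₁ e₂).eval O n A env = if e₁.eval O n A env ≠ 0 then e₂.eval O n A env else 0 :=
  rfl

theorem eval_query (e : Exp k) :
    (query e).eval O n A env = if O (e.eval O n A env) = true then 1 else 0 :=
  rfl

theorem eval_cellIndex (u v : Fin k) :
    (cellIndex u v).eval O n A env = env v + n * env u := by
  simp [cellIndex, eval]

theorem eval_sum (e : Exp (k + 1)) :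
    (sum e).eval O n A env = ∑ x : Fin n, e.eval O n A (vecCons x env) :=
  (Fin.sum_univ_eq_sum_range (fun x => e.eval O n A (vecCons x env)) n).symm

theorem eval_sum_eq_zero_iff {e : Exp (k + 1)} :
    (sum e).eval O n A env = 0 ↔ ∀ x : Fin n, e.eval O n A (vecCons x env) = 0 := by
  simp [eval_sum]

end Exp

/-- The array `A` begins with the entries of the `n × n` matrix `f`, in row-major order. -/
def IsTable {n : ℕ} (f : Fin n → Fin n → ℕ) (A : ℕ → ℕ) : Prop :=
  ∀ u v : Fin n, A (v + n * u) = f u v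

theorem IsTable.eval_entry {n : ℕ} {f : Fin n → Fin n → ℕ} {O : ℕ → Bool} {A : ℕ → ℕ → ℕ} {a : ℕ}
    (h : IsTable f (A a)) {k : ℕ} {env : Fin k → ℕ} {i j : Fin k} {u v : Fin n} (hu : env i = u)
    (hv : env j = v) : (Exp.entry a i j).eval O n A env = f u v := by
  rw [Exp.entry, Exp.eval, Exp.eval_cellIndex, hu, hv, h]

section Tabulate

variable {O : ℕ → Bool} {n k i a : ℕ} {f : Fin n → Fin n → ℕ} {A A' : ℕ → ℕ → ℕ}
  {ρ env : Fin k → ℕ} {s : Store}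

/-- Write the value of `e`, whose variables `1` and `0` stand for the row and the column, to that
cell of the table in array `a`. -/
def writeCell (i a : ℕ) (ρ : Fin (k + 2) → ℕ) (e : Exp (k + 2)) : Program :=
  .seq (e.compile ρ i) (.seq ((Exp.cellIndex 1 0).compile ρ (i + 1)) (.store a (i + 1) i))

/-- A bound for the running time of `writeCell`, as a polynomial in the size of the table. -/
noncomputable def writeCellCost (e : Exp (k + 2)) : Polynomial ℕ :=
  e.cost + ((Exp.cellIndex 1 0 : Exp (k + 2)).cost + 1)

/-- Fill array `a` with the table of the values of `e`, whose variables `1` and `0` stand for the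
row and the column, and whose other variables are in the registers `ρ`. -/
def tabulate (i a : ℕ) (ρ : Fin k → ℕ) (e : Exp (k + 2)) : Program :=
  forLoop i (forLoop (i + 3) (writeCell (i + 6) a (vecCons (i + 3) (vecCons i ρ)) e))

/-- A bound for the running time of `tabulate`, as a polynomial in the size of the table. -/
noncomputable def tabulateCost (e : Exp (k + 2)) : Polynomial ℕ :=
  loopCost (loopCost (writeCellCost e))

/-- The first `m` cells of the table for `f` have been written to array `a`, and the other arrays
are still those of `A`. -/
structure Filled (f : Fin n → Fin n → ℕ) (a : ℕ) (A : ℕ → ℕ → ℕ) (m : ℕ) (A' : ℕ → ℕ → ℕ) :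
    Prop where
  other : ∀ b ≠ a, A' b = A b
  cell : ∀ u v : Fin n, (v + n * u : ℕ) < m → A' a (v + n * u) = f u v

theorem cellIndex_injective {u v u' v' : Fin n} (h : (v + n * u : ℕ) = v' + n * u') :
    u = u' ∧ v = v' :=
  Prod.ext_iff.1 (finProdFinEquiv.injective (a₁ := (u, v)) (a₂ := (u', v')) (Fin.ext h))

theorem Filled.setArr {u v : Fin n} (h : Filled f a A (v + n * u) s.arr) :
    Filled f a A (v + 1 + n * u) (s.setArr a (v + n * u) (f u v)).arr where
  other b hb := (s.setArr_arr_of_ne _ _ _ hb).trans (h.other b hb)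
  cell u' v' hlt := by
    rw [Store.setArr_arr_self]
    split_ifs with heq
    · obtain ⟨rfl, rfl⟩ := cellIndex_injective heq
      rfl
    · exact h.cell u' v' (by omega)

theorem haltsWithin_writeCell {e : Exp (k + 2)} {ρ : Fin (k + 2) → ℕ} {u v : Fin n}
    (h : Frame n A' ρ (vecCons v (vecCons u env)) i s)
    (he : e.eval O n A' (vecCons v (vecCons u env)) = f u v)
    (hA' : Filled f a A (v + n * u) A') :
    HaltsWithin O (writeCell i a ρ e) ((writeCellCost e).eval n)
      (fun s' => EqOn s'.reg s.reg (Iio i) ∧ Filled f a A (v + 1 + n * u) s'.arr) s := by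
  simp only [writeCellCost, Polynomial.eval_add, Polynomial.eval_one]
  refine .seq ((e.computes h).mono le_rfl fun s₁ ⟨hval, hs₁⟩ => .seq ?_)
  have hcell := (Exp.cellIndex 1 0).computes (O := O) ((h.unchanged hs₁).mono i.le_succ)
  refine hcell.mono le_rfl fun s₂ ⟨hidx, hs₂⟩ => .of_run_one (.store _ _ _ _) ?_
  rw [Exp.eval_cellIndex] at hidx
  have hval' : s₂.reg i = f u v := (hs₂.1 i.lt_succ_self).trans (hval.trans he)
  have harr : s₂.arr = A' := hs₂.2.trans (hs₁.2.trans h.arr)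
  refine ⟨(hs₂.mono i.le_succ).1.trans hs₁.1, ?_⟩
  rw [hidx, hval']
  exact Filled.setArr (harr ▸ hA')

theorem haltsWithin_writeRow {e : Exp (k + 2)} {u : Fin n}
    (h : Frame n A' (vecCons i ρ) (vecCons u env) (i + 3) s)
    (he : ∀ v : Fin n, ∀ A', (∀ b ≠ a, A' b = A b) →
      e.eval O n A' (vecCons v (vecCons u env)) = f u v)
    (hA' : Filled f a A (n * u) A') :
    HaltsWithin O (forLoop (i + 3) (writeCell (i + 6) a (vecCons (i + 3) (vecCons i ρ)) e))
      ((loopCost (writeCellCost e)).eval n)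
      (fun s' => EqOn s'.reg s.reg (Iio (i + 3)) ∧ Filled f a A (n * (u + 1)) s'.arr) s := by
  rw [eval_loopCost, Nat.mul_succ n u, Nat.add_comm (n * u)]
  refine haltsWithin_forLoop (I := fun v s' => Filled f a A (v + n * u) s'.arr) h.one_lt h.size
    (fun _ hs' => hs') (fun v hv s' heq hv' hs' => ?_) (by simpa only [zero_add, h.arr] using hA')
  exact haltsWithin_writeCell (v := ⟨v, hv⟩) ((h.congr heq rfl).cons (by omega) hv')
    (he _ _ hs'.other) hs'

theorem haltsWithin_tabulate {e : Exp (k + 2)} (h : Frame n A ρ env i s)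
    (he : ∀ u v : Fin n, ∀ A', (∀ b ≠ a, A' b = A b) →
      e.eval O n A' (vecCons v (vecCons u env)) = f u v) :
    HaltsWithin O (tabulate i a ρ e) ((tabulateCost e).eval n)
      (fun s' => EqOn s'.reg s.reg (Iio i) ∧ (∀ b ≠ a, s'.arr b = A b) ∧ IsTable f (s'.arr a))
      s := by
  have h0 : Filled f a A (n * 0) s.arr := ⟨fun _ _ => by rw [h.arr], by simp⟩
  rw [tabulateCost, eval_loopCost]
  refine (haltsWithin_forLoop (I := fun u s' => Filled f a A (n * u) s'.arr) h.one_lt h.size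
    (fun _ hs' => hs') (fun u hu s' heq hu' hs' => ?_) h0).mono le_rfl fun s' ⟨heq, hs'⟩ =>
      ⟨heq, hs'.other, fun u v => hs'.cell u v (finProdFinEquiv (u, v)).2⟩
  exact haltsWithin_writeRow (u := ⟨u, hu⟩) ((h.congr heq rfl).cons (by omega) hu') (he _) hs'

end Tabulate

end OracleRAM

namespace GroupRep

open OracleRAM
open Set (EqOn Iio)

section Decision

variable {n : ℕ} {T : SimpleGraph (Fin n)} {r : Fin n} {E : Setoid (Fin n)} {O : ℕ → Bool}
  {A : ℕ → ℕ → ℕ} {s : Store}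

open Classical in
/-- The `0`-`1` matrix of a relation. -/
noncomputable def indicatorMatrix (R : Fin n → Fin n → Prop) (u v : Fin n) : ℕ :=
  if R u v then 1 else 0

theorem indicatorMatrix_ne_zero_iff {R : Fin n → Fin n → Prop} {u v : Fin n} :
    indicatorMatrix R u v ≠ 0 ↔ R u v := by
  simp [indicatorMatrix]

theorem isTable_adjTable (T : SimpleGraph (Fin n)) :
    IsTable (indicatorMatrix T.Adj) (adjTable T) := fun u v => by
  obtain ⟨hu, hv⟩ := Prod.ext_iff.1 (finProdFinEquiv.symm_apply_apply (u, v))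
  have hlt : (v + n * u : ℕ) < n * n := (finProdFinEquiv (u, v)).2
  change Fin.divNat ⟨v + n * u, hlt⟩ = u at hu
  change Fin.modNat ⟨v + n * u, hlt⟩ = v at hv
  rw [adjTable, dif_pos hlt, hu, hv, indicatorMatrix]

/-- The arrays describe the tree and a partition of its vertices: array `1` holds the adjacency
matrix of `T` and array `2` the matrix of the equivalence relation `E`. -/
structure Describes (T : SimpleGraph (Fin n)) (E : Setoid (Fin n)) (A : ℕ → ℕ → ℕ) : Prop where
  adj : IsTable (indicatorMatrix T.Adj) (A 1)
  rel : IsTable (indicatorMatrix ⇑E) (A 2)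

/-- The number of neighbours of `u` in the class of `w`. -/
def countExp {k : ℕ} (u w : Fin k) : Exp k :=
  .sum (.and (.entry 1 u.succ 0) (.entry 2 0 w.succ))

theorem Describes.eval_countExp (h : Describes T E A) {k : ℕ} {env : Fin k → ℕ} {i j : Fin k}
    {u w : Fin n} (hu : env i = u) (hw : env j = w) :
    (countExp i j).eval O n A env = nbrCount T E u w := by
  classical
  have hterm (x : Fin n) : (Exp.and (.entry 1 i.succ 0) (.entry 2 0 j.succ)).eval O n A
      (Matrix.vecCons x env) = if x ∈ nbrClass T E u w then 1 else 0 := by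
    have hadj : (Exp.entry 1 i.succ 0).eval O n A (Matrix.vecCons x env) =
      indicatorMatrix T.Adj u x := h.adj.eval_entry hu rfl
    have hrel : (Exp.entry 2 0 j.succ).eval O n A (Matrix.vecCons x env) =
      indicatorMatrix ⇑E x w := h.rel.eval_entry rfl hw
    simp only [Exp.eval_and, hadj, hrel, indicatorMatrix_ne_zero_iff]
    rw [indicatorMatrix, ← ite_and]
    exact if_congr Iff.rfl rfl rfl
  rw [countExp, Exp.eval_sum, Finset.sum_congr rfl fun x _ => hterm x, Finset.sum_boole,
    Nat.cast_id, nbrCount, Nat.card_eq_fintype_card, Fintype.card_subtype]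

/-- The relation from which colour refinement starts, between the variables `1` and `0`; variable
`2` is the root. -/
def initExp : Exp 3 := .eq (.eq (.var 1) (.var 2)) (.eq (.var 0) (.var 2))

theorem eval_initExp (u v : Fin n) :
    initExp.eval O n A ![v, u, r] = indicatorMatrix ⇑(Setoid.ker (· = r)) u v := by
  classical
  have hiff : ((if (u : ℕ) = r then 1 else 0) = if (v : ℕ) = r then 1 else 0) ↔
      Setoid.ker (· = r) u v := by
    simp only [Setoid.ker_def, Fin.ext_iff, eq_iff_iff]
    split_ifs <;> simp [*]
  simp only [initExp, Exp.eval_eq]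
  exact if_congr hiff rfl rfl

/-- The relation after one more round of colour refinement, between the variables `1` and `0`. -/
def refineExp : Exp 2 :=
  .and (.entry 2 1 0) (.isZero (.sum (.ne (countExp 2 0) (countExp 1 0))))

theorem Describes.eval_refineExp (h : Describes T E A) (u v : Fin n) :
    refineExp.eval O n A ![v, u] = indicatorMatrix ⇑(refine T E) u v := by
  classical
  have hrel : (Exp.entry 2 1 0).eval O n A ![v, u] = indicatorMatrix ⇑E u v :=
    h.rel.eval_entry rfl rfl
  have hu (x : Fin n) : (countExp 2 0).eval O n A ![x, v, u] = nbrCount T E u x :=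
    h.eval_countExp rfl rfl
  have hv (x : Fin n) : (countExp 1 0).eval O n A ![x, v, u] = nbrCount T E v x :=
    h.eval_countExp rfl rfl
  simp only [refineExp, Exp.eval_and, Exp.eval_isZero, Exp.eval_sum_eq_zero_iff,
    Exp.eval_ne_eq_zero_iff, hu, hv, ← funext_iff]
  rw [hrel, ← ite_and, indicatorMatrix]
  exact if_congr (and_congr_left' indicatorMatrix_ne_zero_iff) rfl rfl

/-- A nonzero number if and only if, for some adjacent `v` and `x`, the oracle answers yes on the
number of neighbours of `v` in the class of `x`. -/
def answerExp : Exp 0 :=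
  .sum (.sum (.and (.entry 1 1 0) (.query (countExp 1 0))))

theorem Describes.eval_answerExp_ne_zero_iff (h : Describes T E A) :
    answerExp.eval O n A ![] ≠ 0 ↔ ∃ v x, T.Adj v x ∧ O (nbrCount T E v x) = true := by
  have hadj (v x : Fin n) : (Exp.entry 1 1 0).eval O n A ![x, v] = indicatorMatrix T.Adj v x :=
    h.adj.eval_entry rfl rfl
  have hcount (v x : Fin n) : (countExp 1 0).eval O n A ![x, v] = nbrCount T E v x :=
    h.eval_countExp rfl rfl
  simp [answerExp, Exp.eval_sum_eq_zero_iff, Exp.eval_and, Exp.eval_query, hadj, hcount,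
    indicatorMatrix]

/-- One round of colour refinement. The refined relation is built in array `3`, because its
computation needs the old one. -/
def refineRound (i : ℕ) : Program :=
  .seq (tabulate i 3 ![] refineExp) (tabulate i 2 ![] (.entry 3 1 0))

/-- A bound for the running time of `refineRound`, as a polynomial in the number of vertices. -/
noncomputable def refineRoundCost : Polynomial ℕ :=
  tabulateCost refineExp + tabulateCost (.entry 3 1 0 : Exp 2)

theorem haltsWithin_refineRound {i : ℕ} (h : Frame n A ![] ![] i s) (hA : Describes T E A) :
    HaltsWithin O (refineRound i) (refineRoundCost.eval n)
      (fun s' => EqOn s'.reg s.reg (Iio i) ∧ Describes T (refine T E) s'.arr) s := by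
  rw [refineRoundCost, Polynomial.eval_add]
  refine .seq ((haltsWithin_tabulate (f := indicatorMatrix ⇑(refine T E)) h
    fun u v A' hA' => ?_).mono le_rfl fun s₁ ⟨hreg₁, harr₁, htable₁⟩ => ?_)
  · have hA'' : Describes T E A' := ⟨hA' 1 (by decide) ▸ hA.adj, hA' 2 (by decide) ▸ hA.rel⟩
    exact hA''.eval_refineExp u v
  · refine (haltsWithin_tabulate (f := indicatorMatrix ⇑(refine T E)) (h.congr hreg₁ rfl)
      fun u v A' hA' => ?_).mono le_rfl fun s₂ ⟨hreg₂, harr₂, htable₂⟩ => ?_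
    · exact (hA' 3 (by decide) ▸ htable₁).eval_entry rfl rfl
    · exact ⟨hreg₂.trans hreg₁, harr₂ 1 (by decide) ▸ harr₁ 1 (by decide) ▸ hA.adj, htable₂⟩

/-- Colour refinement on the graph in array `1`, started from the root in register `2`; the
resulting relation is left in array `2`. -/
def refinement : Program :=
  .seq (tabulate 3 2 ![2] initExp) (forLoop 3 (refineRound 6))

/-- A bound for the running time of `refinement`, as a polynomial in the number of vertices. -/
noncomputable def refinementCost : Polynomial ℕ :=
  tabulateCost initExp + loopCost refineRoundCost

theorem haltsWithin_refinement (hn : s.reg 1 = n) (hr : s.reg 2 = r)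
    (hT : IsTable (indicatorMatrix T.Adj) (s.arr 1)) :
    HaltsWithin O refinement (refinementCost.eval n)
      (fun s' => s'.reg 1 = n ∧ Describes T (colourRefinement T r n) s'.arr) s := by
  have hframe : Frame n s.arr ![2] ![(r : ℕ)] 3 s :=
    ⟨by decide, fun _ => by simp, hn, rfl, fun _ => by simpa using hr⟩
  rw [refinementCost, Polynomial.eval_add, eval_loopCost]
  refine .seq ((haltsWithin_tabulate hframe fun u v A' _ => eval_initExp u v).mono le_rfl
    fun s₁ ⟨hreg, harr, htable⟩ => ?_)
  have hn₁ : s₁.reg 1 = n := (hreg (by simp)).trans hn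
  refine (haltsWithin_forLoop (I := fun j s' => Describes T (colourRefinement T r j) s'.arr)
    (by decide) hn₁ (fun _ hs' => hs') (fun j _ s' heq _ hs' => ?_)
    ⟨harr 1 (by decide) ▸ hT, htable⟩).mono le_rfl fun s' ⟨heq, hs'⟩ =>
      ⟨(heq (by simp)).trans hn₁, hs'⟩
  have hframe' : Frame n s'.arr ![] ![] 6 s' :=
    ⟨by decide, (·.elim0), (heq (by simp)).trans hn₁, rfl, (·.elim0)⟩
  rw [colourRefinement_succ]
  exact haltsWithin_refineRound hframe' hs'

/-- The decision procedure: colour refinement, followed by a query about the number of neighbours of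
`v` in the class of `x`, for all adjacent `v` and `x`. -/
def decisionProgram : Program :=
  .seq refinement (.seq (answerExp.compile ![] 3) (move 0 3))

/-- A bound for the running time of `decisionProgram`, as a polynomial in the number of vertices. -/
noncomputable def decisionCost : Polynomial ℕ :=
  refinementCost + (answerExp.cost + 2)

theorem haltsWithin_decisionProgram (hn : s.reg 1 = n) (hr : s.reg 2 = r)
    (hT : IsTable (indicatorMatrix T.Adj) (s.arr 1)) :
    HaltsWithin O decisionProgram (decisionCost.eval n) (fun s' => s'.reg 0 ≠ 0 ↔
      ∃ v x, T.Adj v x ∧ O (nbrCount T (colourRefinement T r n) v x) = true) s := by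
  simp only [decisionCost, Polynomial.eval_add, Polynomial.eval_ofNat]
  refine .seq ((haltsWithin_refinement hn hr hT).mono le_rfl fun s₁ ⟨hn₁, hs₁⟩ => .seq ?_)
  have hframe : Frame n s₁.arr ![] ![] 3 s₁ :=
    ⟨by decide, (·.elim0), hn₁, rfl, (·.elim0)⟩
  refine (answerExp.computes hframe).mono le_rfl fun s₂ ⟨hval, _⟩ => ?_
  refine haltsWithin_move (by decide) ?_
  simp only [Store.setReg_reg, if_pos, hval]
  exact hs₁.eval_answerExp_ne_zero_iff

end Decision

theorem eval_le_eval (p : Polynomial ℕ) {a b : ℕ} (h : a ≤ b) : p.eval a ≤ p.eval b := by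
  rw [Polynomial.eval_eq_sum_range, Polynomial.eval_eq_sum_range]
  gcongr

end GroupRep

theorem mainTheorem4_general :
    ∃ (P : OracleRAM.Program) (p : Polynomial ℕ),
      ∀ (G : Type*) [Group G] (n : ℕ) (T : SimpleGraph (Fin n)) (_ : T.IsTree) (r : Fin n)
        (O : ℕ → Bool),
        (∀ m : ℕ, 1 ≤ m → m ≤ n → (O m = true ↔ GroupRep.HasNontrivialPermRep G m)) →
        ∀ s : OracleRAM.Store, s.reg 1 = n → s.reg 2 = r → s.arr 1 = GroupRep.adjTable T →
          ∃ (t : ℕ) (s' : OracleRAM.Store), OracleRAM.Run O P s t s' ∧ t ≤ p.eval n ∧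
            (s'.reg 0 ≠ 0 ↔ GroupRep.RepresentableOn G T r) := by
  refine ⟨GroupRep.decisionProgram, GroupRep.decisionCost, fun G _ n T hT r O hO s hn hr hadj => ?_⟩
  have hrun := GroupRep.haltsWithin_decisionProgram (O := O) hn hr
    (hadj ▸ GroupRep.isTable_adjTable T)
  refine hrun.mono le_rfl fun s' hs' => hs'.trans ?_
  rw [GroupRep.representableOn_iff hT, Nat.card_fin]
  refine exists_congr fun v => exists_congr fun x => and_congr_right fun hvx => ?_
  obtain ⟨hpos, hle⟩ := GroupRep.nbrCount_mem_Icc hvx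
  exact hO _ hpos (hle.trans_eq (Nat.card_fin n))

theorem mainTheorem4 :
    ∃ (P : OracleRAM.Program) (p : Polynomial ℕ),
      ∀ (G : Type*) [Group G] (N n : ℕ) (e : G ≃ Fin N)
        (T : SimpleGraph (Fin n)) (_ : T.IsTree) (r : Fin n) (O : ℕ → Bool),
        (∀ m : ℕ, 1 ≤ m → m ≤ n → (O m = true ↔ GroupRep.HasNontrivialPermRep G m)) →
        ∃ (t : ℕ) (s : OracleRAM.Store),
          OracleRAM.Run O P (GroupRep.inputStore e T r) t s ∧
          t ≤ p.eval (N + n) ∧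
          (s.reg 0 ≠ 0 ↔ GroupRep.RepresentableOn G T r) := by
  obtain ⟨P, p, h⟩ := mainTheorem4_general
  exact ⟨P, p, fun G _ N n e T hT r O hO => OracleRAM.HaltsWithin.mono
    (h G n T hT r O hO _ rfl rfl rfl) (GroupRep.eval_le_eval p (Nat.le_add_left n N)) fun _ => id⟩
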